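/- All Banach algebras are complex and need not be unital or commutative. A Banach algebra $B$ is called contractible if every continuous derivation $D:B\to E$ into a Banach $B$-bimodule $E$ is inner, i.e. there is $z\in E$ with $D(b)=z\cdot b-b\cdot z$ for all $b\in B$. For a Banach algebra $B$, the second dual $B^{**}$ is regarded as a Banach algebra with the first Arens product, and $\Delta(B)$ denotes the set of non-zero multiplicative continuous linear functionals on $B$. Let $X$ be a non-empty locally compact Hausdorff space and let $A$ be a Banach algebra with $\Delta(A)\neq\emptyset$. Let $C_b(X,A)$ be the Banach algebra of bounded continuous functions $X\to A$, and $C_0(X,A)$ the Banach algebra of continuous functions $X\to A$ vanishing at infinity, both with pointwise operations and the supremum norm. Then the following assertions are equivalent: (a) $C_b(X,A)$ is contractible; (b) $C_0(X,A)$ is contractible; (c) $X$ is finite and $A$ is contractible. Likewise, the following assertions are equivalent: (a$'$) $C_b(X,A)^{**}$ is contractible; (b$'$) $C_0(X,A)^{**}$ is contractible; (c$'$) $X$ is finite and $A^{**}$ is contractible. -/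

import Mathlib

open scoped BoundedContinuousFunction ZeroAtInfty

universe u v

/-- The structure of a Banach `A`-bimodule on a (complete) normed space `E`: bounded bilinear left
and right actions of `A` on `E` that are associative and commute with each other. No unit is assumed
in `A`, and the actions are not assumed to be essential. -/
structure BanachBimodule (A : Type u) (E : Type v) [NonUnitalNormedRing A] [NormedSpace ℂ A]
    [NormedAddCommGroup E] [NormedSpace ℂ E] where
  /-- `left a x` is `a · x`. -/
  left : A →L[ℂ] E →L[ℂ] E
  /-- `right a x` is `x · a`. -/
  right : A →L[ℂ] E →L[ℂ] E
  left_mul : ∀ (a b : A) (x : E), left (a * b) x = left a (left b x)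
  right_mul : ∀ (a b : A) (x : E), right (a * b) x = right b (right a x)
  left_right : ∀ (a b : A) (x : E), right b (left a x) = left a (right b x)

namespace BanachBimodule

variable {A : Type u} {E : Type v} [NonUnitalNormedRing A] [NormedSpace ℂ A]
  [NormedAddCommGroup E] [NormedSpace ℂ E]

/-- `D (a b) = D a · b + a · D b`. -/
def IsDerivation (M : BanachBimodule A E) (D : A →L[ℂ] E) : Prop :=
  ∀ a b : A, D (a * b) = M.right b (D a) + M.left a (D b)

/-- There is `z` with `D a = z · a - a · z` for all `a`. -/
def IsInner (M : BanachBimodule A E) (D : A →L[ℂ] E) : Prop :=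
  ∃ z : E, ∀ a : A, D a = M.right a z - M.left a z

end BanachBimodule

/-- A Banach algebra `A` is contractible if every continuous derivation from `A` into a Banach
`A`-bimodule is inner. The bimodules range over a universe at least as large as that of `A`. -/
def IsContractible.{k, l} (A : Type l) [NonUnitalNormedRing A] [NormedSpace ℂ A] : Prop :=
  ∀ (E : Type (max l k)) [NormedAddCommGroup E] [NormedSpace ℂ E] [CompleteSpace E]
    (M : BanachBimodule A E) (D : A →L[ℂ] E), M.IsDerivation D → M.IsInner D

/-- The second dual `A**` of a normed space, as a Banach space. -/
def Bidual (A : Type u) [NormedAddCommGroup A] [NormedSpace ℂ A] : Type u :=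
  (A →L[ℂ] ℂ) →L[ℂ] ℂ

namespace Bidual

section NormedSpace

variable (A : Type u) [NormedAddCommGroup A] [NormedSpace ℂ A]

noncomputable instance : NormedAddCommGroup (Bidual A) :=
  inferInstanceAs (NormedAddCommGroup ((A →L[ℂ] ℂ) →L[ℂ] ℂ))

noncomputable instance : NormedSpace ℂ (Bidual A) :=
  inferInstanceAs (NormedSpace ℂ ((A →L[ℂ] ℂ) →L[ℂ] ℂ))

instance : CompleteSpace (Bidual A) :=
  inferInstanceAs (CompleteSpace ((A →L[ℂ] ℂ) →L[ℂ] ℂ))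

noncomputable instance : FunLike (Bidual A) (A →L[ℂ] ℂ) ℂ :=
  inferInstanceAs (FunLike ((A →L[ℂ] ℂ) →L[ℂ] ℂ) (A →L[ℂ] ℂ) ℂ)

variable {A}

theorem ext {m n : Bidual A} (h : ∀ f : A →L[ℂ] ℂ, m f = n f) : m = n :=
  ContinuousLinearMap.ext h

theorem add_apply (m n : Bidual A) (f : A →L[ℂ] ℂ) : (m + n) f = m f + n f := rfl

theorem smul_apply (c : ℂ) (m : Bidual A) (f : A →L[ℂ] ℂ) : (c • m) f = c • m f := rfl

theorem zero_apply (f : A →L[ℂ] ℂ) : (0 : Bidual A) f = 0 := rfl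

theorem map_add' (m : Bidual A) (f g : A →L[ℂ] ℂ) : m (f + g) = m f + m g :=
  ContinuousLinearMap.map_add (σ₁₂ := RingHom.id ℂ) m f g

theorem map_smul' (m : Bidual A) (c : ℂ) (f : A →L[ℂ] ℂ) : m (c • f) = c • m f :=
  ContinuousLinearMap.map_smul (R₁ := ℂ) m c f

theorem map_zero' (m : Bidual A) : m (0 : A →L[ℂ] ℂ) = 0 :=
  ContinuousLinearMap.map_zero (σ₁₂ := RingHom.id ℂ) m

theorem le_opNorm (m : Bidual A) (f : A →L[ℂ] ℂ) : ‖m f‖ ≤ ‖m‖ * ‖f‖ :=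
  ContinuousLinearMap.le_opNorm (σ₁₂ := RingHom.id ℂ) m f

theorem opNorm_le_bound (m : Bidual A) {C : ℝ} (hC : 0 ≤ C)
    (h : ∀ f : A →L[ℂ] ℂ, ‖m f‖ ≤ C * ‖f‖) : ‖m‖ ≤ C :=
  ContinuousLinearMap.opNorm_le_bound (σ₁₂ := RingHom.id ℂ) m hC h

end NormedSpace

section Arens

variable {A : Type u} [NonUnitalNormedRing A] [NormedSpace ℂ A] [IsScalarTower ℂ A A]
  [SMulCommClass ℂ A A]

/-- The right action of `A` on `A*`: `⟨f · a, b⟩ = ⟨f, a b⟩`. -/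
noncomputable def dualAct : (A →L[ℂ] ℂ) →L[ℂ] A →L[ℂ] (A →L[ℂ] ℂ) :=
  ((ContinuousLinearMap.compL ℂ A (A →L[ℂ] A) (A →L[ℂ] ℂ)).flip (ContinuousLinearMap.mul ℂ A)).comp
    (ContinuousLinearMap.compL ℂ A A ℂ)

theorem dualAct_apply (f : A →L[ℂ] ℂ) (a b : A) : dualAct f a b = f (a * b) := rfl

/-- The action of `A**` on `A*`: `⟨n · f, a⟩ = ⟨n, f · a⟩`. -/
noncomputable def bidualAct (n : Bidual A) : (A →L[ℂ] ℂ) →L[ℂ] (A →L[ℂ] ℂ) :=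
  (ContinuousLinearMap.compL ℂ A (A →L[ℂ] ℂ) ℂ n).comp dualAct

theorem bidualAct_apply (n : Bidual A) (f : A →L[ℂ] ℂ) (a : A) :
    bidualAct n f a = n (dualAct f a) := rfl

/-- The first Arens product: `⟨m n, f⟩ = ⟨m, n · f⟩`. -/
noncomputable instance : Mul (Bidual A) where
  mul m n := ContinuousLinearMap.comp (σ₁₂ := RingHom.id ℂ) (σ₂₃ := RingHom.id ℂ) m (bidualAct n)

theorem mul_apply (m n : Bidual A) (f : A →L[ℂ] ℂ) : (m * n) f = m (bidualAct n f) := rfl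

theorem norm_dualAct_le (f : A →L[ℂ] ℂ) (a : A) : ‖dualAct f a‖ ≤ ‖f‖ * ‖a‖ := by
  refine ContinuousLinearMap.opNorm_le_bound _ (by positivity) fun b => ?_
  rw [dualAct_apply, mul_assoc]
  exact (f.le_opNorm _).trans (by gcongr; exact norm_mul_le a b)

theorem norm_bidualAct_le (n : Bidual A) (f : A →L[ℂ] ℂ) : ‖bidualAct n f‖ ≤ ‖n‖ * ‖f‖ := by
  refine ContinuousLinearMap.opNorm_le_bound _ (by positivity) fun a => ?_
  rw [bidualAct_apply, mul_assoc]
  exact (n.le_opNorm _).trans (by gcongr; exact norm_dualAct_le f a)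

theorem dualAct_mul (f : A →L[ℂ] ℂ) (a b : A) : dualAct f (a * b) = dualAct (dualAct f a) b := by
  ext c
  simp [dualAct_apply, mul_assoc]

theorem bidualAct_dualAct (n : Bidual A) (f : A →L[ℂ] ℂ) (a : A) :
    bidualAct n (dualAct f a) = dualAct (bidualAct n f) a := by
  ext b
  rw [bidualAct_apply, dualAct_apply, bidualAct_apply, dualAct_mul]

theorem bidualAct_mul (m n : Bidual A) (f : A →L[ℂ] ℂ) :
    bidualAct (m * n) f = bidualAct m (bidualAct n f) := by
  ext a
  rw [bidualAct_apply, mul_apply, bidualAct_dualAct, bidualAct_apply]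

theorem bidualAct_add (m n : Bidual A) (f : A →L[ℂ] ℂ) :
    bidualAct (m + n) f = bidualAct m f + bidualAct n f := rfl

theorem bidualAct_smul (c : ℂ) (m : Bidual A) (f : A →L[ℂ] ℂ) :
    bidualAct (c • m) f = c • bidualAct m f := rfl

theorem bidualAct_zero (f : A →L[ℂ] ℂ) : bidualAct (0 : Bidual A) f = 0 := rfl

/-- `A**` with the first Arens product and the dual norm is a Banach algebra. -/
noncomputable instance : NonUnitalNormedRing (Bidual A) where
  toNorm := (inferInstance : NormedAddCommGroup (Bidual A)).toNorm
  toMetricSpace := (inferInstance : NormedAddCommGroup (Bidual A)).toMetricSpace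
  __ := (inferInstance : NormedAddCommGroup (Bidual A)).toAddCommGroup
  mul := (· * ·)
  dist_eq := (inferInstance : NormedAddCommGroup (Bidual A)).dist_eq
  left_distrib a b c := ext fun f => by
    rw [mul_apply, bidualAct_add, map_add', add_apply, mul_apply, mul_apply]
  right_distrib a b c := ext fun f => by
    rw [mul_apply, add_apply, add_apply, mul_apply, mul_apply]
  zero_mul a := ext fun f => by rw [mul_apply, zero_apply, zero_apply]
  mul_zero a := ext fun f => by rw [mul_apply, bidualAct_zero, map_zero', zero_apply]
  mul_assoc a b c := ext fun f => by
    rw [mul_apply, mul_apply, mul_apply, bidualAct_mul]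
  norm_mul_le m n := by
    refine opNorm_le_bound _ (by positivity) fun f => ?_
    rw [mul_apply, mul_assoc]
    exact (m.le_opNorm _).trans (by gcongr; exact norm_bidualAct_le n f)

instance : IsScalarTower ℂ (Bidual A) (Bidual A) where
  smul_assoc c m n := ext fun f => by
    rw [smul_eq_mul, smul_eq_mul, mul_apply, smul_apply, smul_apply, mul_apply]

instance : SMulCommClass ℂ (Bidual A) (Bidual A) where
  smul_comm c m n := ext fun f => by
    rw [smul_eq_mul, smul_eq_mul, mul_apply, smul_apply, mul_apply, bidualAct_smul, map_smul']

end Arens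

end Bidual

-- A contractible algebra has only finitely many characters. Let `Γ` be the compact space of
-- multiplicative functionals, zero included. The derivation `b ↦ 1 ⊗ b - b ⊗ 1` into the functions
-- on `Γ × Γ` vanishing on the diagonal is inner. Its implementing function must be 1 off the
-- diagonal and is 0 on it, so `Γ` is discrete, hence finite.
--
-- If `φ` is a character of `A`, the functionals `φ ∘ ev x` are distinct for distinct points, so
-- contractibility of a function algebra on `X` forces `X` to be finite. `A` inherits
-- contractibility as the image of an evaluation. Conversely, over a finite `X` the algebra is a
-- finite direct sum of copies of `A`, and `IsContractible.of_finite_sum` applies.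
--
-- Characters, surjectivity of evaluations and direct sum decompositions all pass to second duals,
-- so the same argument serves there. `IsContractible.iff_of_eval` treats both function algebras at
-- once.

universe w

/-! ### Functoriality of the second dual -/

namespace Bidual

section Map

variable {A : Type u} {B : Type v} [NormedAddCommGroup A] [NormedSpace ℂ A]
  [NormedAddCommGroup B] [NormedSpace ℂ B]

/-- The second adjoint of a continuous linear map. -/
noncomputable def map (T : A →L[ℂ] B) : Bidual A →L[ℂ] Bidual B :=
  (ContinuousLinearMap.compL ℂ (B →L[ℂ] ℂ) (A →L[ℂ] ℂ) ℂ).flip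
    ((ContinuousLinearMap.compL ℂ A B ℂ).flip T)

theorem map_apply (T : A →L[ℂ] B) (m : Bidual A) (f : B →L[ℂ] ℂ) : map T m f = m (f.comp T) :=
  rfl

/-- Evaluation of elements of the second dual at a functional. -/
noncomputable def eval (f : A →L[ℂ] ℂ) : Bidual A →L[ℂ] ℂ :=
  ContinuousLinearMap.apply ℂ ℂ f

theorem eval_apply (f : A →L[ℂ] ℂ) (m : Bidual A) : eval f m = m f := rfl

theorem sum_map_map_eq {ι : Type*} [Fintype ι] {S : ι → A →L[ℂ] B} {T : ι → B →L[ℂ] A}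
    (h : ∑ i, (S i).comp (T i) = ContinuousLinearMap.id ℂ B) (m : Bidual B) :
    ∑ i, map (S i) (map (T i) m) = m := by
  refine ext fun f => ?_
  calc (∑ i, map (S i) (map (T i) m)) f = ∑ i, map (S i) (map (T i) m) f :=
        _root_.map_sum (eval f) _ _
    _ = m (∑ i, (f.comp (S i)).comp (T i)) :=
        (_root_.map_sum (AddMonoidHom.mk' m (map_add' m)) _ _).symm
    _ = m (f.comp (∑ i, (S i).comp (T i))) := by
        congr 1
        ext b
        simp
    _ = m f := by rw [h, ContinuousLinearMap.comp_id]

/-- The canonical image in the second dual. -/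
noncomputable def of (a : A) : Bidual A := ContinuousLinearMap.apply ℂ ℂ a

end Map

section MapMul

variable {A : Type u} [NonUnitalNormedRing A] [NormedSpace ℂ A] [IsScalarTower ℂ A A]
  [SMulCommClass ℂ A A] {B : Type v} [NonUnitalNormedRing B] [NormedSpace ℂ B]
  [IsScalarTower ℂ B B] [SMulCommClass ℂ B B]

theorem map_mul {T : A →L[ℂ] B} (hT : ∀ a b, T (a * b) = T a * T b) (m n : Bidual A) :
    map T (m * n) = map T m * map T n := by
  refine ext fun f => ?_
  rw [map_apply, mul_apply, mul_apply, map_apply]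
  congr 1
  ext a
  rw [bidualAct_apply, ContinuousLinearMap.comp_apply, bidualAct_apply, map_apply]
  congr 1
  ext b
  simp [dualAct_apply, hT]

/-- For multiplicative `f` the Arens action is scalar: `n · f = n(f) f`. -/
theorem eval_mul {f : A →L[ℂ] ℂ} (hf : ∀ a b, f (a * b) = f a * f b) (m n : Bidual A) :
    eval f (m * n) = eval f m * eval f n := by
  rw [eval_apply, mul_apply, eval_apply, eval_apply]
  have h : bidualAct n f = n f • f := by
    ext a
    rw [bidualAct_apply]
    have : dualAct f a = f a • f := by
      ext b
      simp [dualAct_apply, hf]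
    rw [this, map_smul']
    simp [mul_comm]
  rw [h, map_smul', smul_eq_mul, mul_comm]

end MapMul

section MapMulZero

variable {A : Type u} [NormedAddCommGroup A] [NormedSpace ℂ A] {B : Type v}
  [NonUnitalNormedRing B] [NormedSpace ℂ B] [IsScalarTower ℂ B B] [SMulCommClass ℂ B B]

/-- Orthogonality of the summands survives in the second dual. Neither map need be multiplicative,
since `f` composed with the product already vanishes on the two ranges. -/
theorem map_mul_map_eq_zero {S T : A →L[ℂ] B} (h : ∀ a b, S a * T b = 0) (m n : Bidual A) :
    map S m * map T n = 0 := by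
  refine ext fun f => ?_
  have h0 : (bidualAct (map T n) f).comp S = 0 := by
    ext a
    have h1 : (dualAct f (S a)).comp T = 0 := by
      ext b
      simp [dualAct_apply, h]
    rw [ContinuousLinearMap.comp_apply, bidualAct_apply, map_apply, h1, map_zero']
    rfl
  rw [mul_apply, map_apply, h0, map_zero', zero_apply]

end MapMulZero

end Bidual

/-! ### Constructions of bimodules and derivations -/

namespace BanachBimodule

section Constructions

variable {A : Type u} {B : Type w} {E : Type v} [NonUnitalNormedRing A] [NormedSpace ℂ A]
  [NonUnitalNormedRing B] [NormedSpace ℂ B] [NormedAddCommGroup E] [NormedSpace ℂ E]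

/-- Restriction of scalars along a continuous homomorphism. -/
noncomputable def comap (M : BanachBimodule A E) (π : B →L[ℂ] A)
    (hπ : ∀ a b, π (a * b) = π a * π b) : BanachBimodule B E where
  left := M.left.comp π
  right := M.right.comp π
  left_mul a b x := by simp [hπ, M.left_mul]
  right_mul a b x := by simp [hπ, M.right_mul]
  left_right a b x := by simp [M.left_right]

theorem IsDerivation.comap {M : BanachBimodule A E} {D : A →L[ℂ] E} (hD : M.IsDerivation D)
    (π : B →L[ℂ] A) (hπ : ∀ a b, π (a * b) = π a * π b) :
    (M.comap π hπ).IsDerivation (D.comp π) := fun a b => by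
  simp [BanachBimodule.comap, hπ, hD (π a) (π b)]

/-- Transport of a bimodule structure along a continuous linear equivalence. -/
noncomputable def congr {F : Type w} [NormedAddCommGroup F] [NormedSpace ℂ F]
    (M : BanachBimodule A E) (e : E ≃L[ℂ] F) : BanachBimodule A F where
  left := (e.arrowCongr e : (E →L[ℂ] E) →L[ℂ] (F →L[ℂ] F)).comp M.left
  right := (e.arrowCongr e : (E →L[ℂ] E) →L[ℂ] (F →L[ℂ] F)).comp M.right
  left_mul a b x := by simp [M.left_mul]
  right_mul a b x := by simp [M.right_mul]
  left_right a b x := by simp [M.left_right]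

/-- The inner derivation implemented by `z`. -/
noncomputable def inner (M : BanachBimodule A E) (z : E) : A →L[ℂ] E :=
  M.right.flip z - M.left.flip z

theorem inner_apply (M : BanachBimodule A E) (z : E) (a : A) :
    M.inner z a = M.right a z - M.left a z := rfl

theorem IsDerivation.sub_inner {M : BanachBimodule A E} {D : A →L[ℂ] E} (hD : M.IsDerivation D)
    (z : E) : M.IsDerivation (D - M.inner z) := fun a b => by
  simp only [sub_apply, inner_apply, hD a b, M.left_mul, M.right_mul, map_sub,
    M.left_right]
  abel

theorem IsInner.of_sub_inner {M : BanachBimodule A E} {D : A →L[ℂ] E} {z : E}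
    (h : M.IsInner (D - M.inner z)) : M.IsInner D := by
  obtain ⟨w, hw⟩ := h
  refine ⟨w + z, fun a => ?_⟩
  have := hw a
  rw [sub_apply, inner_apply, sub_eq_iff_eq_add] at this
  rw [this, map_add, map_add]
  abel

section Ideal

variable {R : Type w} [NormedCommRing R] [NormedAlgebra ℂ R]

/-- Multiplication on an ideal of a commutative normed algebra. -/
noncomputable def mulIdeal (I : Submodule ℂ R) (hI : ∀ f, ∀ K ∈ I, f * K ∈ I) : R →L[ℂ] I →L[ℂ] I :=
  LinearMap.mkContinuous₂
    (LinearMap.mk₂ ℂ (fun f K => ⟨f * K.1, hI f K.1 K.2⟩)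
      (fun f g K => Subtype.ext (add_mul f g K.1))
      (fun c f K => Subtype.ext (smul_mul_assoc c f K.1))
      (fun f K L => Subtype.ext (mul_add f K.1 L.1))
      (fun c f K => Subtype.ext (mul_smul_comm c f K.1))) 1
    fun f K => by rw [one_mul]; exact norm_mul_le f K.1

theorem coe_mulIdeal (I : Submodule ℂ R) (hI : ∀ f, ∀ K ∈ I, f * K ∈ I) (f : R) (K : I) :
    (mulIdeal I hI f K : R) = f * K := rfl

/-- An ideal of a commutative normed algebra as a bimodule along two homomorphisms. -/
noncomputable def ofIdeal (I : Submodule ℂ R) (hI : ∀ f, ∀ K ∈ I, f * K ∈ I) (P Q : A →L[ℂ] R)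
    (hP : ∀ a b, P (a * b) = P a * P b) (hQ : ∀ a b, Q (a * b) = Q a * Q b) :
    BanachBimodule A I where
  left := (mulIdeal I hI).comp P
  right := (mulIdeal I hI).comp Q
  left_mul a b K := Subtype.ext <| by simp [coe_mulIdeal, hP, mul_assoc]
  right_mul a b K := Subtype.ext <| by simp [coe_mulIdeal, hQ, mul_assoc, mul_left_comm]
  left_right a b K := Subtype.ext <| by simp [coe_mulIdeal, mul_left_comm]

end Ideal

end Constructions

end BanachBimodule

/-! ### Identities, images and finite sums -/

namespace IsContractible

open BanachBimodule

/-- Derivations into bimodules in the universe of the algebra are inner. -/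
theorem isInner.{k, l} {A : Type l} [NonUnitalNormedRing A] [NormedSpace ℂ A]
    (hA : IsContractible.{k} A) {E : Type l} [NormedAddCommGroup E] [NormedSpace ℂ E]
    [CompleteSpace E] (M : BanachBimodule A E) {D : A →L[ℂ] E} (hD : M.IsDerivation D) :
    M.IsInner D := by
  -- Contractibility tests bimodules in the larger universe, so `E` is lifted there.
  let e : E ≃L[ℂ] ULift.{k} E := ContinuousLinearEquiv.ulift.symm
  obtain ⟨z, hz⟩ := hA (ULift.{k} E) (M.congr e) ((e : E →L[ℂ] ULift.{k} E).comp D)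
    fun a b => by simp [BanachBimodule.congr, hD a b]
  refine ⟨e.symm z, fun a => e.injective ?_⟩
  simpa [BanachBimodule.congr] using hz a

section Unit

variable {A : Type v} [NonUnitalNormedRing A] [NormedSpace ℂ A] [IsScalarTower ℂ A A]
  [SMulCommClass ℂ A A] [CompleteSpace A]

/-- A contractible Banach algebra has an identity. -/
theorem exists_one.{k} (hA : IsContractible.{k} A) : ∃ e : A, ∀ a, e * a = a ∧ a * e = a := by
  -- With one action zero, the identity map of `A` is a derivation; an implementing element is, up
  -- to sign, a one-sided identity.
  let L : BanachBimodule A A :=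
    { left := ContinuousLinearMap.mul ℂ A
      right := 0
      left_mul := fun a b x => by simp [mul_assoc]
      right_mul := fun a b x => by simp
      left_right := fun a b x => by simp }
  let R : BanachBimodule A A :=
    { left := 0
      right := (ContinuousLinearMap.mul ℂ A).flip
      left_mul := fun a b x => by simp
      right_mul := fun a b x => by simp [mul_assoc]
      left_right := fun a b x => by simp }
  obtain ⟨r, hr⟩ := hA.isInner L (D := ContinuousLinearMap.id ℂ A) fun a b => by simp [L]
  obtain ⟨l, hl⟩ := hA.isInner R (D := ContinuousLinearMap.id ℂ A) fun a b => by simp [R]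
  have hr' : ∀ a, a * -r = a := fun a => by simpa [L] using (hr a).symm
  have hl' : ∀ a, l * a = a := fun a => by simpa [R] using (hl a).symm
  have h : l = -r := (hr' l).symm.trans (hl' _)
  exact ⟨l, fun a => ⟨hl' a, h ▸ hr' a⟩⟩

end Unit

/-- Contractibility passes to images under continuous homomorphisms. -/
theorem of_surjective {B : Type (max u v)} [NonUnitalNormedRing B] [NormedSpace ℂ B]
    {A : Type v} [NonUnitalNormedRing A] [NormedSpace ℂ A] (hB : IsContractible.{max u v} B)
    (π : B →L[ℂ] A) (hπ : ∀ a b, π (a * b) = π a * π b) (hs : Function.Surjective π) :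
    IsContractible.{max u v} A := by
  intro E _ _ _ M D hD
  obtain ⟨z, hz⟩ := hB E (M.comap π hπ) (D.comp π) (hD.comap π hπ)
  refine ⟨z, fun a => ?_⟩
  obtain ⟨b, rfl⟩ := hs a
  exact hz b

/-- A finite direct sum of copies of a contractible Banach algebra is contractible. -/
theorem of_finite_sum {ι : Type u} [Fintype ι] {B : Type (max u v)} [NonUnitalNormedRing B]
    [NormedSpace ℂ B] {A : Type v} [NonUnitalNormedRing A] [NormedSpace ℂ A]
    [IsScalarTower ℂ A A] [SMulCommClass ℂ A A] [CompleteSpace A]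
    (hA : IsContractible.{max u v} A) (σ : ι → A →L[ℂ] B) (π : ι → B →L[ℂ] A)
    (hσ : ∀ i a b, σ i (a * b) = σ i a * σ i b) (hne : ∀ i j, i ≠ j → ∀ a b, σ i a * σ j b = 0)
    (hsum : ∀ b, ∑ i, σ i (π i b) = b) : IsContractible.{max u v} B := by
  intro E _ _ _ M
  obtain ⟨o, ho⟩ := hA.exists_one
  set e : ι → B := fun i => σ i o with he
  have heσ : ∀ i a, e i * σ i a = σ i a := fun i a => by rw [he, ← hσ, (ho a).1]
  have hσe : ∀ i a, σ i a * e i = σ i a := fun i a => by rw [he, ← hσ, (ho a).2]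
  set f : B := ∑ i, e i with hf
  have hfb : ∀ b, f * b = b := fun b => by
    conv_lhs => rw [← hsum b]
    rw [hf, Finset.sum_mul_sum]
    conv_rhs => rw [← hsum b]
    refine Finset.sum_congr rfl fun i _ => ?_
    rw [Finset.sum_eq_single i (fun j _ hj => hne i j hj.symm _ _) (by simp), heσ]
  -- A derivation killing all the `e i` is inner.
  have key : ∀ D : B →L[ℂ] E, M.IsDerivation D → (∀ i, D (e i) = 0) → M.IsInner D := by
    intro D hD h0
    have hz : ∀ i, ∃ z : E, ∀ a, D (σ i a) = M.right (σ i a) z - M.left (σ i a) z := fun i =>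
      hA E (M.comap (σ i) (hσ i)) (D.comp (σ i)) (hD.comap (σ i) (hσ i))
    choose z hz using hz
    have hl : ∀ i a, D (σ i a) = M.left (e i) (D (σ i a)) := fun i a => by
      conv_lhs => rw [← heσ i a, hD, h0, map_zero, zero_add]
    have hr : ∀ i a, D (σ i a) = M.right (e i) (D (σ i a)) := fun i a => by
      conv_lhs => rw [← hσe i a, hD, h0, map_zero, add_zero]
    -- Since `D (σ i a)` is fixed by `e i` on both sides, `z i` may be cut down to `e i · z i · e
    -- i`, which the other summands annihilate.
    refine ⟨∑ i, M.left (e i) (M.right (e i) (z i)), fun b => ?_⟩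
    rw [← hsum b]
    simp only [map_sum, sum_apply, ← Finset.sum_sub_distrib]
    refine Finset.sum_congr rfl fun i _ => ?_
    rw [Finset.sum_eq_single i]
    · rw [hl, hr, hz, map_sub, map_sub, M.left_right, M.left_right, ← M.right_mul, ← M.left_mul,
        hσe, heσ]
      rw [← M.right_mul, heσ, ← M.left_mul, hσe]
    · intro j _ hj
      rw [M.left_right, ← M.right_mul, ← M.left_mul, hne i j hj.symm, hne j i hj, map_zero, map_zero,
        zero_apply, zero_apply, map_zero, sub_zero]
    · simp
  -- A derivation killing the identity is inner.
  have key' : ∀ D : B →L[ℂ] E, M.IsDerivation D → D f = 0 → M.IsInner D := by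
    intro D hD h0
    -- This averages `D` over the diagonal `∑ e i ⊗ e i`. As `D f = 0`, `f · D (e j) = D (e j)`, so
    -- the inner derivation agrees with `D` at every `e j`.
    refine IsInner.of_sub_inner (z := -∑ i, M.left (e i) (D (e i))) (key _ (hD.sub_inner _) ?_)
    intro j
    have h1 : D (e j) = M.left f (D (e j)) := by
      conv_lhs => rw [← hfb (e j), hD, h0, map_zero, zero_add]
    have h2 : ∀ i, M.right (e j) (M.left (e i) (D (e i))) =
        M.left (e i) (D (e i * e j)) - M.left (e i) (D (e j)) := fun i => by
      rw [hD, map_add, ← M.left_mul, heσ, add_sub_cancel_right, M.left_right]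
    have h3 : M.right (e j) (∑ i, M.left (e i) (D (e i))) =
        M.left (e j) (D (e j)) - D (e j) := by
      rw [map_sum, Finset.sum_congr rfl fun i _ => h2 i, Finset.sum_sub_distrib,
        Finset.sum_eq_single j, heσ, ← sum_apply, ← map_sum, ← hf, ← h1]
      · intro i _ hi
        rw [hne i j hi, map_zero, map_zero]
      · simp
    have h4 : M.left (e j) (∑ i, M.left (e i) (D (e i))) = M.left (e j) (D (e j)) := by
      rw [map_sum, Finset.sum_eq_single j, ← M.left_mul, heσ]
      · intro i _ hi
        rw [← M.left_mul, hne j i hi.symm, map_zero, zero_apply]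
      · simp
    rw [sub_apply, inner_apply, map_neg, map_neg, h3, h4]
    abel
  intro D hD
  -- The bimodule need not be unital, so `D f` may be non-zero. Since `f` is idempotent, `f · D f ·
  -- f = 0`, and this `z` gives `z · f - f · z = D f · f + f · D f = D f`.
  refine IsInner.of_sub_inner (z := M.right f (D f) - M.left f (D f))
    (key' _ (hD.sub_inner _) ?_)
  have h1 : D f = M.right f (D f) + M.left f (D f) := by rw [← hD, hfb]
  have h2 : M.left f (M.right f (D f)) = 0 := by
    have := congrArg (fun x => M.left f (M.right f x)) h1
    simp only [map_add, M.left_right, ← M.left_mul, ← M.right_mul, hfb] at this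
    simpa using this
  rw [sub_apply, inner_apply, map_sub, map_sub, M.left_right, h2, ← M.left_mul, ← M.right_mul,
    hfb, sub_zero, zero_sub, sub_neg_eq_add, sub_eq_zero]
  exact h1

end IsContractible

/-! ### Finiteness of the set of characters -/

section Characters

variable {B : Type v} [NonUnitalNormedRing B] [NormedSpace ℂ B]

/-- From `|φ a|² = |φ (a²)| ≤ ‖φ‖ ‖a‖²` follows `‖φ‖ ≤ √‖φ‖`; no unit is needed. -/
theorem norm_multiplicative_le_one (φ : B →L[ℂ] ℂ) (hφ : ∀ a b, φ (a * b) = φ a * φ b) :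
    ‖φ‖ ≤ 1 := by
  have h : ‖φ‖ ≤ √‖φ‖ := by
    refine φ.opNorm_le_bound (Real.sqrt_nonneg _) fun a => ?_
    refine (Real.le_sqrt (norm_nonneg _) (by positivity)).2 ?_ |>.trans_eq
      (show √(‖φ‖ * ‖a‖ ^ 2) = _ from ?_)
    · calc ‖φ a‖ ^ 2 = ‖φ (a * a)‖ := by rw [hφ, norm_mul, sq]
        _ ≤ ‖φ‖ * ‖a * a‖ := φ.le_opNorm _
        _ ≤ ‖φ‖ * ‖a‖ ^ 2 := by rw [sq]; gcongr; exact norm_mul_le a a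
    · rw [Real.sqrt_mul (norm_nonneg _), Real.sqrt_sq (norm_nonneg _)]
  have h2 := Real.sq_sqrt (norm_nonneg φ)
  by_contra! hc
  nlinarith [Real.sqrt_nonneg ‖φ‖]

theorem ContinuousMap.norm_comp_le {K L : Type*} [TopologicalSpace K] [CompactSpace K]
    [TopologicalSpace L] [CompactSpace L] (f : C(L, ℂ)) (p : C(K, L)) : ‖f.comp p‖ ≤ ‖f‖ :=
  (ContinuousMap.norm_le _ (norm_nonneg _)).2 fun x => f.norm_coe_le_norm (p x)

variable (B) in
/-- The multiplicative continuous functionals, zero included, with the weak-star topology. -/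
def MultiplicativeFunctionals : Set (WeakDual ℂ B) :=
  {φ | ∀ a b, φ (a * b) = φ a * φ b}

local notation "Γ" => MultiplicativeFunctionals

namespace MultiplicativeFunctionals

/-- Banach–Alaoglu: admitting zero makes this bounded set weak-star closed even without a unit. -/
instance compactSpace : CompactSpace (Γ B) := by
  refine isCompact_iff_compactSpace.1 (WeakDual.isCompact_of_bounded_of_closed ?_ ?_)
  · refine (Metric.isBounded_closedBall (x := (0 : StrongDual ℂ B)) (r := 1)).subset fun φ hφ => ?_
    exact mem_closedBall_zero_iff.2 (norm_multiplicative_le_one _ hφ)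
  · simp only [MultiplicativeFunctionals, Set.ofPred_forall]
    exact isClosed_iInter fun a => isClosed_iInter fun b => isClosed_eq
      (WeakDual.eval_continuous _) ((WeakDual.eval_continuous _).mul (WeakDual.eval_continuous _))

/-- The Gelfand transform on the multiplicative functionals. -/
noncomputable def gelfand (b : B) : C(Γ B, ℂ) :=
  ⟨fun γ => γ.1 b, (WeakDual.eval_continuous b).comp continuous_subtype_val⟩

theorem gelfand_apply (b : B) (γ : Γ B) :
    gelfand b γ = γ.1 b := rfl

theorem norm_gelfand_le (b : B) : ‖gelfand b‖ ≤ ‖b‖ := by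
  refine (ContinuousMap.norm_le _ (norm_nonneg _)).2 fun γ => ?_
  have h : ‖(WeakDual.toStrongDual γ.1)‖ ≤ 1 := norm_multiplicative_le_one _ γ.2
  exact ((WeakDual.toStrongDual γ.1).le_of_opNorm_le h b).trans_eq (one_mul _)

variable (B) in
/-- The continuous functions on the square that vanish on the diagonal. -/
def diagonalIdeal : Submodule ℂ C(Γ B × Γ B, ℂ) where
  carrier := {K | ∀ γ, K (γ, γ) = 0}
  add_mem' h h' γ := by simp [h γ, h' γ]
  zero_mem' γ := rfl
  smul_mem' c K h γ := by simp [h γ]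

theorem isClosed_diagonalIdeal :
    IsClosed (diagonalIdeal B : Set C(Γ B × Γ B, ℂ)) := by
  have : (diagonalIdeal B : Set C(Γ B × Γ B, ℂ)) = {K | ∀ γ, K (γ, γ) = 0} := rfl
  rw [this, Set.ofPred_forall]
  exact isClosed_iInter fun γ => isClosed_eq (ContinuousEvalConst.continuous_eval_const _)
    continuous_const

instance completeSpace_diagonalIdeal :
    CompleteSpace (diagonalIdeal B) :=
  isClosed_diagonalIdeal.completeSpace_coe

/-- The Gelfand transform composed with a coordinate of the square. -/
noncomputable def pull (p : C(Γ B × Γ B, Γ B)) :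
    B →L[ℂ] C(Γ B × Γ B, ℂ) :=
  LinearMap.mkContinuous
    { toFun := fun b => (gelfand b).comp p
      map_add' := fun a b => by ext x; simp [gelfand_apply]
      map_smul' := fun c b => by ext x; simp [gelfand_apply] } 1 fun b => by
    rw [one_mul]
    exact (ContinuousMap.norm_comp_le (gelfand b) p).trans (norm_gelfand_le b)

theorem pull_apply (p : C(Γ B × Γ B, Γ B)) (b : B)
    (x : Γ B × Γ B) : pull p b x = (p x).1 b := rfl

theorem pull_mul (p : C(Γ B × Γ B, Γ B)) (a b : B) :
    pull p (a * b) = pull p a * pull p b := by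
  ext x
  exact (p x).2 a b

theorem mul_mem_diagonalIdeal (f : C(Γ B × Γ B, ℂ))
    {K : C(Γ B × Γ B, ℂ)} (hK : K ∈ diagonalIdeal B) : f * K ∈ diagonalIdeal B := fun γ => by
  rw [ContinuousMap.mul_apply, hK γ, mul_zero]

variable (B) in
/-- The functions vanishing on the diagonal, as a bimodule. -/
noncomputable def bimodule :
    BanachBimodule B (diagonalIdeal B) :=
  .ofIdeal (diagonalIdeal B) (fun f _ => mul_mem_diagonalIdeal f) (pull ContinuousMap.fst)
    (pull ContinuousMap.snd) (pull_mul _) (pull_mul _)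

variable (B) in
/-- The derivation `b ↦ 1 ⊗ b - b ⊗ 1`. -/
noncomputable def derivation : B →L[ℂ] diagonalIdeal B :=
  (pull ContinuousMap.snd - pull ContinuousMap.fst).codRestrict (diagonalIdeal B) fun b γ => by
    simp [pull_apply]

theorem derivation_apply (b : B) (x : Γ B × Γ B) :
    (derivation B b).1 x = x.2.1 b - x.1.1 b := rfl

theorem bimodule_left_apply (b : B) (K : diagonalIdeal B)
    (x : Γ B × Γ B) : ((bimodule B).left b K).1 x = x.1.1 b * K.1 x := rfl

theorem bimodule_right_apply (b : B) (K : diagonalIdeal B)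
    (x : Γ B × Γ B) : ((bimodule B).right b K).1 x = x.2.1 b * K.1 x := rfl

theorem isDerivation_derivation :
    (bimodule B).IsDerivation (derivation B) := fun a b => by
  refine Subtype.ext (ContinuousMap.ext fun x => ?_)
  rw [Submodule.coe_add, ContinuousMap.add_apply, bimodule_left_apply, bimodule_right_apply,
    derivation_apply, derivation_apply, derivation_apply, x.1.2 a b, x.2.2 a b]
  ring

end MultiplicativeFunctionals

namespace IsContractible

open MultiplicativeFunctionals

/-- Off the diagonal some `b` separates the coordinates, and cancelling `x.2 b - x.1 b` gives `z =
1`. On the diagonal `z = 0`, so continuity isolates each point of a compact space. -/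
theorem finite_multiplicativeFunctionals.{k} (hB : IsContractible.{k} B) : Finite (Γ B) := by
  obtain ⟨z, hz⟩ := hB.isInner (bimodule B) isDerivation_derivation
  have hne : ∀ x : Γ B × Γ B, x.1 ≠ x.2 → z.1 x = 1 := by
    intro x hx
    obtain ⟨b, hb⟩ : ∃ b, x.1.1 b ≠ x.2.1 b := by
      by_contra! h
      exact hx (Subtype.ext (DFunLike.ext _ _ h))
    have h := congrArg (fun K : diagonalIdeal B => K.1 x) (hz b)
    rw [Submodule.coe_sub, ContinuousMap.sub_apply, bimodule_left_apply, bimodule_right_apply,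
      derivation_apply, ← sub_mul] at h
    exact (mul_eq_left₀ (sub_ne_zero.2 hb.symm)).1 h.symm
  have hd : DiscreteTopology (Γ B) := by
    refine discreteTopology_iff_isOpen_singleton.2 fun γ => ?_
    have : ({γ} : Set (Γ B)) = (fun γ' => z.1 (γ, γ')) ⁻¹' {1}ᶜ := by
      ext γ'
      simp only [Set.mem_singleton_iff, Set.mem_preimage, Set.mem_compl_iff]
      constructor
      · rintro rfl
        rw [z.2]
        exact zero_ne_one
      · intro h
        by_contra hc
        exact h (hne (γ, γ') (Ne.symm hc))
    rw [this]
    exact isOpen_compl_singleton.preimage (z.1.continuous.comp (by fun_prop))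
  exact finite_of_compact_of_discrete

/-- A contractible Banach algebra has only finitely many characters. -/
theorem finite_of_separating.{k, l} (hB : IsContractible.{k} B) {ι : Type l}
    (χ : ι → B →L[ℂ] ℂ) (hχ : ∀ i a b, χ i (a * b) = χ i a * χ i b)
    (hsep : ∀ i j, i ≠ j → ∃ b, χ i b ≠ χ j b) : Finite ι :=
  have := hB.finite_multiplicativeFunctionals
  Finite.of_injective (fun i => (⟨χ i, hχ i⟩ : Γ B)) fun i j h => by
    by_contra hij
    obtain ⟨b, hb⟩ := hsep i j hij
    exact hb (congrArg (fun γ : Γ B => γ.1 b) h)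

end IsContractible

end Characters

/-! ### Algebras of functions with enough sections -/

/-- The characterization of contractibility for an algebra `B` of `A`-valued functions on `X` that
separates points from finite sets, and for its second dual. -/
theorem IsContractible.iff_of_eval (X : Type u) (A : Type v) [NonUnitalNormedRing A]
    [NormedSpace ℂ A] [IsScalarTower ℂ A A] [SMulCommClass ℂ A A] [CompleteSpace A] [Nonempty X]
    (hA : (WeakDual.characterSpace ℂ A).Nonempty) (B : Type (max u v)) [NonUnitalNormedRing B]
    [NormedSpace ℂ B] [IsScalarTower ℂ B B] [SMulCommClass ℂ B B] (ev : X → B →L[ℂ] A)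
    (hmul : ∀ x a b, ev x (a * b) = ev x a * ev x b)
    (hinj : ∀ a b, (∀ x, ev x a = ev x b) → a = b)
    (hsep : ∀ (x : X) (F : Finset X), x ∉ F →
      ∃ σ : A →L[ℂ] B, (∀ a, ev x (σ a) = a) ∧ ∀ y ∈ F, ∀ a, ev y (σ a) = 0) :
    (IsContractible.{max u v} B ↔ Finite X ∧ IsContractible.{max u v} A) ∧
    (IsContractible.{max u v} (Bidual B) ↔ Finite X ∧ IsContractible.{max u v} (Bidual A)) := by
  classical
  obtain ⟨φ', hφ0, hφ⟩ := hA
  let φ : A →L[ℂ] ℂ := WeakDual.toStrongDual φ'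
  replace hφ : ∀ a b, φ (a * b) = φ a * φ b := hφ
  obtain ⟨a₀, ha₀⟩ : ∃ a, φ a ≠ 0 := by
    by_contra! h
    exact hφ0 (DFunLike.ext _ _ h)
  let χ : X → B →L[ℂ] ℂ := fun x => φ.comp (ev x)
  have hχ : ∀ x a b, χ x (a * b) = χ x a * χ x b := fun x a b => by simp [χ, hmul, hφ]
  have hχsep : ∀ x y, x ≠ y → ∃ b, χ x b ≠ χ y b := fun x y hxy => by
    obtain ⟨σ, hσ, hσ'⟩ := hsep x {y} (by simpa using hxy)
    exact ⟨σ a₀, by simpa [χ, hσ, hσ'] using ha₀⟩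
  obtain ⟨x₀⟩ := ‹Nonempty X›
  obtain ⟨τ, hτ, -⟩ := hsep x₀ ∅ (by simp)
  have hsum : Finite X → ∃ (_ : Fintype X) (σ : X → A →L[ℂ] B),
      (∀ i a b, σ i (a * b) = σ i a * σ i b) ∧ (∀ i j, i ≠ j → ∀ a b, σ i a * σ j b = 0) ∧
      ∑ i, (σ i).comp (ev i) = ContinuousLinearMap.id ℂ B := by
    intro hX
    have := Fintype.ofFinite X
    have h : ∀ x, ∃ σ : A →L[ℂ] B, (∀ a, ev x (σ a) = a) ∧ ∀ y, y ≠ x → ∀ a, ev y (σ a) = 0 := by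
      intro x
      obtain ⟨σ, h1, h2⟩ := hsep x (Finset.univ.erase x) (by simp)
      exact ⟨σ, h1, fun y hy => h2 y (by simpa using hy)⟩
    choose σ h1 h2 using h
    -- Each section is now supported at one point, so multiplicativity, orthogonality and the
    -- decomposition of the identity can be checked pointwise.
    refine ⟨this, σ, fun i a b => hinj _ _ fun x => ?_, fun i j hij a b => hinj _ _ fun x => ?_, ?_⟩
    · rw [hmul]
      by_cases hx : x = i
      · subst hx; rw [h1, h1, h1]
      · rw [h2 _ _ hx, h2 _ _ hx, zero_mul]
    · rw [hmul, map_zero]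
      by_cases hx : x = i
      · subst hx; rw [h2 j x hij, mul_zero]
      · rw [h2 _ _ hx, zero_mul]
    · ext b : 1
      refine hinj _ _ fun x => ?_
      rw [sum_apply, map_sum, Finset.sum_eq_single x]
      · exact h1 x _
      · exact fun i _ hi => h2 i x hi.symm _
      · simp
  refine ⟨⟨fun h => ⟨?_, ?_⟩, fun ⟨hX, h⟩ => ?_⟩, ⟨fun h => ⟨?_, ?_⟩, fun ⟨hX, h⟩ => ?_⟩⟩
  · exact h.finite_of_separating χ hχ hχsep
  · exact h.of_surjective (ev x₀) (hmul x₀) fun a => ⟨τ a, hτ a⟩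
  · obtain ⟨_, σ, h1, h2, h3⟩ := hsum hX
    exact h.of_finite_sum σ ev h1 h2 fun b => by simpa using DFunLike.congr_fun h3 b
  · refine h.finite_of_separating (fun x => Bidual.eval (χ x)) (fun x => Bidual.eval_mul (hχ x))
      fun x y hxy => ?_
    obtain ⟨b, hb⟩ := hχsep x y hxy
    exact ⟨Bidual.of b, hb⟩
  -- The linear section `τ` suffices for surjectivity: its second adjoint is again a right inverse.
  · refine h.of_surjective (Bidual.map (ev x₀)) (Bidual.map_mul (hmul x₀)) fun m =>
      ⟨Bidual.map τ m, Bidual.ext fun f => ?_⟩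
    rw [Bidual.map_apply, Bidual.map_apply]
    congr 1
    ext a
    simp [hτ]
  · obtain ⟨_, σ, h1, h2, h3⟩ := hsum hX
    refine h.of_finite_sum (fun i => Bidual.map (σ i)) (fun i => Bidual.map (ev i))
      (fun i => Bidual.map_mul (h1 i)) (fun i j hij => Bidual.map_mul_map_eq_zero (h2 i j hij))
      (Bidual.sum_map_map_eq h3)

/-! ### Evaluations and Urysohn sections -/

section Evaluation

variable {X : Type u} [TopologicalSpace X] {A : Type v} [NonUnitalNormedRing A] [NormedSpace ℂ A]
  [IsScalarTower ℂ A A] [SMulCommClass ℂ A A]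

/-- Compact support puts `g` in `C₀`, so `a ↦ g a` is a section for both function algebras; the
bound 1 makes it contractive. -/
theorem exists_urysohn_finset [LocallyCompactSpace X] [T2Space X] (x : X) (F : Finset X)
    (hx : x ∉ F) : ∃ g : C₀(X, ℂ), g x = 1 ∧ (∀ y ∈ F, g y = 0) ∧ ∀ y, ‖g y‖ ≤ 1 := by
  obtain ⟨f, h1, h0, hc, hf⟩ := exists_continuous_one_zero_of_isCompact (isCompact_singleton (x := x))
    F.finite_toSet.isClosed (Set.disjoint_singleton_left.2 hx)
  refine ⟨⟨⟨fun y => (f y : ℂ), by fun_prop⟩, ?_⟩, ?_, fun y hy => ?_, fun y => ?_⟩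
  · have := hc.is_zero_at_infty
    simpa [Function.comp_def] using (Complex.continuous_ofReal.tendsto 0).comp this
  · simpa using h1 rfl
  · simpa using h0 hy
  · simpa [abs_of_nonneg (hf y).1] using (hf y).2

/-- Evaluation at a point of a bounded continuous function. -/
noncomputable def BoundedContinuousFunction.evalAt (x : X) : (X →ᵇ A) →L[ℂ] A :=
  LinearMap.mkContinuous
    { toFun := fun f => f x, map_add' := fun _ _ => rfl, map_smul' := fun _ _ => rfl } 1 fun f => by
    rw [one_mul]; exact f.norm_coe_le_norm x

/-- Evaluation at a point of a continuous function vanishing at infinity. -/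
noncomputable def ZeroAtInftyContinuousMap.evalAt (x : X) : C₀(X, A) →L[ℂ] A :=
  LinearMap.mkContinuous
    { toFun := fun f => f x, map_add' := fun _ _ => rfl, map_smul' := fun _ _ => rfl } 1 fun f => by
    rw [one_mul]; exact f.toBCF.norm_coe_le_norm x

/-- The map `a ↦ g a` into the functions vanishing at infinity. -/
noncomputable def ZeroAtInftyContinuousMap.smulConst (g : C₀(X, ℂ)) (hg : ∀ y, ‖g y‖ ≤ 1) :
    A →L[ℂ] C₀(X, A) :=
  LinearMap.mkContinuous
    { toFun := fun a => ⟨⟨fun y => g y • a, by fun_prop⟩, by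
        simpa using (ZeroAtInftyContinuousMap.zero_at_infty' g).smul_const a⟩
      map_add' := fun a b => by ext y; simp
      map_smul' := fun c a => by ext y; exact smul_comm _ _ _ } 1 fun a => by
    rw [one_mul]
    refine (BoundedContinuousFunction.norm_le (norm_nonneg a)).2 fun y => ?_
    exact (norm_smul_le _ _).trans (mul_le_of_le_one_left (norm_nonneg a) (hg y))

/-- The inclusion of the functions vanishing at infinity into the bounded functions. -/
noncomputable def ZeroAtInftyContinuousMap.toBCFL : C₀(X, A) →L[ℂ] (X →ᵇ A) :=
  LinearMap.mkContinuous
    { toFun := fun f => f.toBCF, map_add' := fun _ _ => rfl, map_smul' := fun _ _ => rfl } 1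
    fun f => by rw [one_mul]; exact le_rfl

end Evaluation

theorem mainTheorem3 (X : Type u) [TopologicalSpace X] [LocallyCompactSpace X] [T2Space X]
    [Nonempty X] (A : Type v) [NonUnitalNormedRing A] [NormedSpace ℂ A] [IsScalarTower ℂ A A]
    [SMulCommClass ℂ A A] [CompleteSpace A] (hA : (WeakDual.characterSpace ℂ A).Nonempty) :
    List.TFAE
      [IsContractible.{max u v} (X →ᵇ A),
       IsContractible.{max u v} C₀(X, A),
       Finite X ∧ IsContractible.{max u v} A] ∧
    List.TFAE
      [IsContractible.{max u v} (Bidual (X →ᵇ A)),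
       IsContractible.{max u v} (Bidual C₀(X, A)),
       Finite X ∧ IsContractible.{max u v} (Bidual A)] := by
  obtain ⟨hb, hb'⟩ := IsContractible.iff_of_eval X A hA (X →ᵇ A)
    BoundedContinuousFunction.evalAt (fun _ _ _ => rfl)
    (fun _ _ h => BoundedContinuousFunction.ext h) fun x F hx => by
      obtain ⟨g, h1, h0, hg⟩ := exists_urysohn_finset x F hx
      refine ⟨ZeroAtInftyContinuousMap.toBCFL.comp (ZeroAtInftyContinuousMap.smulConst g hg),
        fun a => ?_, fun y hy a => ?_⟩
      · exact (congrArg (· • a) h1).trans (one_smul ℂ a)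
      · exact (congrArg (· • a) (h0 y hy)).trans (zero_smul ℂ a)
  obtain ⟨h0, h0'⟩ := IsContractible.iff_of_eval X A hA C₀(X, A)
    ZeroAtInftyContinuousMap.evalAt (fun _ _ _ => rfl)
    (fun _ _ h => ZeroAtInftyContinuousMap.ext h) fun x F hx => by
      obtain ⟨g, h1, h0, hg⟩ := exists_urysohn_finset x F hx
      refine ⟨ZeroAtInftyContinuousMap.smulConst g hg, fun a => ?_, fun y hy a => ?_⟩
      · exact (congrArg (· • a) h1).trans (one_smul ℂ a)
      · exact (congrArg (· • a) (h0 y hy)).trans (zero_smul ℂ a)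
  constructor
  · tfae_have 1 ↔ 3 := hb
    tfae_have 2 ↔ 3 := h0
    tfae_finish
  · tfae_have 1 ↔ 3 := hb'
    tfae_have 2 ↔ 3 := h0'
    tfae_finish
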